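/- Let $X$ be a finite set. For a symmetric function $W\colon X\times X\to\mathbb R$, $W(x,y)=W(y,x)$, let $$Z_W(\mathbf w)=\sum_{k=0}^\infty \frac1{k!}\sum_{x_1,\dots,x_k\in X}\Bigl(\prod_{i=1}^k w_{x_i}\Bigr)\Bigl(\prod_{1\le i<j\le k}W(x_i,x_j)\Bigr)$$ be the grand partition function of the lattice gas with fugacities $\mathbf w=(w_x)_{x\in X}$, regarded as a formal power series in $\mathbf w$ with constant term $1$. For a multi-index $\mathbf n=(n_x)_{x\in X}\in\mathbb N^X$ let $|\mathbf n|=\sum_x n_x$ and $\mathbf w^{\mathbf n}=\prod_x w_x^{n_x}$, and let the Mayer coefficient $c_{\mathbf n}(W)$ be the coefficient of $\mathbf w^{\mathbf n}$ in the formal power series $\log Z_W(\mathbf w)=\sum_{m\ge1}\frac{(-1)^{m-1}}{m}(Z_W(\mathbf w)-1)^m$. Call the gas repulsive if $0\le W(x,y)\le1$ for all $x,y\in X$. (i) If the gas is repulsive, then the $c_{\mathbf n}(W)$ are the Taylor coefficients of the analytic function $\log Z_W$ (principal branch) at $\mathbf w=0$: for all $\mathbf w\in\mathbb C^X$ in some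 neighbourhood of $0$ one has $\log Z_W(\mathbf w)=\sum_{\mathbf n}c_{\mathbf n}(W)\,\mathbf w^{\mathbf n}$, with absolute convergence. (ii) For every $\mathbf n$, $c_{\mathbf n}(W)$ is a $C^\infty$ function of the variables $W(x,y)$, one real variable for each unordered pair $\{x,y\}$, with $x=y$ allowed. (iii) If the gas is repulsive, then for all $\mathbf n\in\mathbb N^X$ and all $x,y,x',y'\in X$, $$(-1)^{|\mathbf n|-1}c_{\mathbf n}(W)\ge0,\qquad (-1)^{|\mathbf n|-1}\frac{\partial c_{\mathbf n}(W)}{\partial W(x,y)}\le0,\qquad (-1)^{|\mathbf n|-1}\frac{\partial^2c_{\mathbf n}(W)}{\partial W(x,y)\,\partial W(x',y')}\ge0,$$ where in the partial derivatives $W(x,y)=W(y,x)$ is a single variable. -/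

import Mathlib

open scoped Topology ContDiff

namespace LatticeGas

variable {X : Type*} [Fintype X]

/-- The Boltzmann weight `∏_{1 ≤ i < j ≤ k} W(x_i, x_j)` of the pair interactions of `k` particles
placed at `x_1, …, x_k`. A symmetric two-particle Boltzmann factor `W(x, y) = W(y, x)` on the
finite set `X` is a function `W` on unordered pairs, with `W(x, y) = W s(x, y)`; the diagonal
entries `W(x, x) = W s(x, x)` are included. -/
def pairWeight (W : Sym2 X → ℝ) {k : ℕ} (x : Fin k → X) : ℝ :=
  ∏ i : Fin k, ∏ j ∈ Finset.Ioi i, W s(x i, x j)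

/-- The lattice gas is repulsive: `0 ≤ W(x, y) ≤ 1` for all `x, y`. -/
def IsRepulsive (W : Sym2 X → ℝ) : Prop :=
  ∀ x y : X, 0 ≤ W s(x, y) ∧ W s(x, y) ≤ 1

/-- The `k`-particle term of the grand partition function,
`(1 / k!) ∑_{x_1, …, x_k ∈ X} (∏_i w_{x_i}) (∏_{i < j} W(x_i, x_j))`. -/
noncomputable def partitionTerm (W : Sym2 X → ℝ) (w : X → ℂ) (k : ℕ) : ℂ :=
  (1 / (k.factorial : ℂ)) *
    ∑ x : Fin k → X, (∏ i, w (x i)) * (pairWeight W x : ℂ)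

/-- The grand partition function `Z_W(w)`, as a function of the complex fugacities `w`. -/
noncomputable def partitionFunction (W : Sym2 X → ℝ) (w : X → ℂ) : ℂ :=
  ∑' k : ℕ, partitionTerm W w k

/-- The series defining the partition function of a repulsive gas converges for every `w`. -/
theorem summable_partitionTerm {W : Sym2 X → ℝ} (hW : IsRepulsive W) (w : X → ℂ) :
    Summable (partitionTerm W w) := by
  refine Summable.of_norm_bounded
    (Real.summable_pow_div_factorial (∑ x, ‖w x‖)) fun k => ?_
  have h1 : ∀ x : Fin k → X, |pairWeight W x| ≤ 1 := fun x => by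
    have h0 : 0 ≤ pairWeight W x :=
      Finset.prod_nonneg fun i _ => Finset.prod_nonneg fun j _ => (hW _ _).1
    rw [abs_of_nonneg h0]
    exact Finset.prod_le_one (fun i _ => Finset.prod_nonneg fun j _ => (hW _ _).1)
      fun i _ => Finset.prod_le_one (fun j _ => (hW _ _).1) fun j _ => (hW _ _).2
  have h2 : (∑ x, ‖w x‖) ^ k = ∑ x : Fin k → X, ∏ i, ‖w (x i)‖ := by
    rw [← Fin.prod_const, Finset.prod_univ_sum]
    simp
  rw [partitionTerm, norm_mul, norm_div, norm_one, Complex.norm_natCast, h2, one_div,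
    div_eq_inv_mul]
  gcongr
  refine (norm_sum_le _ _).trans (Finset.sum_le_sum fun x _ => ?_)
  rw [norm_mul, norm_prod, Complex.norm_real]
  exact mul_le_of_le_one_right (Finset.prod_nonneg fun _ _ => norm_nonneg _) (h1 x)

/-- `Z_W` as a formal power series in the fugacities: the coefficient of `w^n` collects the terms
of the grand partition function with `#{i : x_i = x} = n_x` for all `x`. -/
noncomputable def partitionSeries [DecidableEq X] (W : Sym2 X → ℝ) : MvPowerSeries X ℝ :=
  fun n => (1 / (n.degree.factorial : ℝ)) *
    ∑ x : Fin n.degree → X with ∀ y,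
      (Finset.univ.filter fun i => x i = y).card = n y, pairWeight W x

/-- The Mayer coefficient `c_n(W)`: the coefficient of `w^n` in
`log Z_W = ∑_{m ≥ 1} ((-1)^(m - 1) / m) (Z_W - 1)^m`. -/
noncomputable def mayerCoeff [DecidableEq X] (n : X →₀ ℕ) (W : Sym2 X → ℝ) : ℝ :=
  MvPowerSeries.coeff n ((PowerSeries.log ℝ).subst (partitionSeries W - 1))

/-- The partial derivative `∂f / ∂W(e)` of a function of the Boltzmann factors, for an unordered
pair `e`; the other entries of `W` are kept fixed. -/
noncomputable def partialDeriv [DecidableEq X] (e : Sym2 X)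
    (f : (Sym2 X → ℝ) → ℝ) (W : Sym2 X → ℝ) : ℝ :=
  deriv (fun t : ℝ => f (Function.update W e t)) (W e)

end LatticeGas

/-!
The proof uses neither graphs nor Ursell functions. Write `L = log Z_W` and, for `V : X → ℝ`, let
`Q_V(w) = Z_W(V w) / Z_W(w)`, where `V w` is the pointwise product. Adding one particle at `a`
multiplies the fugacity at `c` by `W(a, c)`, so that, with `W_a = W(a, ·)`,

* `w_a ∂L/∂w_a = w_a Q_{W_a}(w)` (`apply_mul_mayerCoeff`);
* `∂L/∂W(a, b) = w_a w_b Q_{W_a W_b}(w)`, halved if `a = b` (`hasDerivAt_mayerCoeff`).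

Since `Q_V = exp (L(V w) - L(w))`, the Euler operator `E = ∑_x w_x ∂/∂w_x` gives
`E Q_V = ((E L)(V w) - (E L)(w)) Q_V` (`euler_partitionRatio`). After the substitution `w ↦ -w`,
with `A_n = (-1)^(|n| - 1) c_n` and with `B_n` the coefficient of `w^n` in `Q_V(-w)`, the last
identity is the recursion `|n| B_n = ∑_{m + k = n} |m| A_m (1 - V^m) B_k`, and the first one says
that `n_a A_n` is a coefficient `B` of degree `|n| - 1`. For `0 ≤ V ≤ 1` every factor on the right
is nonnegative and decreases when `W` and `V` increase. Hence, by induction on the degree, all `A_n`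
and `B_n` are nonnegative and decreasing (`signedMayerCoeff_antitone`,
`signedRatioCoeff_antitone`). By the second identity `∂A_n/∂W(a, b)` is, up to a nonnegative
factor, minus a coefficient `B` for `V = W_a W_b`: it is nonpositive, and it increases in `W`,
which is the claim on the second derivatives.

The three differential identities are instances of one rule for a family of formal power series that
depends differentiably on a parameter, `(log F)' = F' / F` (`HasCoeffDerivAt.log`); the parameter
is a Boltzmann factor `W(a, b)` or a scaling of the fugacities.

Convergence: at `w` the terms of `Z_W - 1` have total norm at most `exp (∑_x |w_x|) - 1`. If this
is less than `1`, the double series over the powers of `Z_W - 1` in the logarithm and over their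
terms converges absolutely, and summing it in both orders gives the claim
(`EvaluatesTo.hasSum_log`).
-/

namespace LatticeGas

/-! ### The logarithm of a formal power series -/

section FormalLog

variable {σ : Type*}

theorem coeff_pow_eq_zero_of_degree_lt {G : MvPowerSeries σ ℝ}
    (hG : MvPowerSeries.constantCoeff G = 0) {n : σ →₀ ℕ} {m : ℕ} (h : n.degree < m) :
    MvPowerSeries.coeff n (G ^ m) = 0 :=
  MvPowerSeries.coeff_eq_zero_of_constantCoeff_nilpotent (m := 1) (by simp [hG]) (by omega)

/-- In degree less than `N` only the powers `G ^ m` with `m < N` contribute to `log (1 + G)`. -/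
theorem coeff_log_subst {G : MvPowerSeries σ ℝ} (hG : MvPowerSeries.constantCoeff G = 0)
    {n : σ →₀ ℕ} {N : ℕ} (hN : n.degree < N) :
    MvPowerSeries.coeff n ((PowerSeries.log ℝ).subst G) =
      ∑ m ∈ Finset.range N,
        PowerSeries.coeff m (PowerSeries.log ℝ) * MvPowerSeries.coeff n (G ^ m) := by
  rw [PowerSeries.coeff_subst (PowerSeries.HasSubst.of_constantCoeff_zero hG),
    finsum_eq_sum_of_support_subset]
  · rfl
  · intro m hm
    by_contra h
    refine hm ?_
    have h' : N ≤ m := by simpa using h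
    simp [coeff_pow_eq_zero_of_degree_lt hG (hN.trans_le h')]

theorem log_subst_rescale [Finite σ] {F : MvPowerSeries σ ℝ}
    (hF : MvPowerSeries.constantCoeff F = 1) (a : σ → ℝ) :
    (PowerSeries.log ℝ).subst (MvPowerSeries.rescale a F - 1) =
      MvPowerSeries.rescale a ((PowerSeries.log ℝ).subst (F - 1)) := by
  have h0 : MvPowerSeries.constantCoeff (F - 1) = 0 := by simp [hF]
  have h1 : MvPowerSeries.rescale a F - 1 = MvPowerSeries.rescale a (F - 1) := by simp
  have h2 : MvPowerSeries.constantCoeff (MvPowerSeries.rescale a (F - 1)) = 0 := by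
    rw [← MvPowerSeries.coeff_zero_eq_constantCoeff_apply, MvPowerSeries.coeff_rescale]
    simp [hF]
  ext n
  rw [h1, coeff_log_subst h2 n.degree.lt_succ_self, MvPowerSeries.coeff_rescale,
    coeff_log_subst h0 n.degree.lt_succ_self, Finset.mul_sum]
  refine Finset.sum_congr rfl fun m _ => ?_
  rw [← map_pow, MvPowerSeries.coeff_rescale]
  ring

/-- `F'` is the coefficientwise derivative at `t` of the family `F` of formal power series. -/
def HasCoeffDerivAt (F : ℝ → MvPowerSeries σ ℝ) (F' : MvPowerSeries σ ℝ) (t : ℝ) : Prop :=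
  ∀ n, HasDerivAt (fun s => MvPowerSeries.coeff n (F s)) (MvPowerSeries.coeff n F') t

variable {F G : ℝ → MvPowerSeries σ ℝ} {F' G' : MvPowerSeries σ ℝ} {t : ℝ}

theorem HasCoeffDerivAt.mul (hF : HasCoeffDerivAt F F' t) (hG : HasCoeffDerivAt G G' t) :
    HasCoeffDerivAt (fun s => F s * G s) (F' * G t + F t * G') t := by
  classical
  intro n
  simp only [MvPowerSeries.coeff_mul, map_add, ← Finset.sum_add_distrib]
  exact HasDerivAt.fun_sum fun p _ => (hF p.1).mul (hG p.2)

theorem HasCoeffDerivAt.pow (hF : HasCoeffDerivAt F F' t) (m : ℕ) :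
    HasCoeffDerivAt (fun s => F s ^ (m + 1)) ((m + 1 : ℕ) • (F t ^ m * F')) t := by
  induction m with
  | zero => simpa using hF
  | succ m ih =>
    have h := ih.mul hF
    simp only [← pow_succ] at h
    convert h using 1
    simp only [nsmul_eq_mul]
    push_cast
    ring

/-- The logarithmic derivative: `(log F)' = F' / F`, coefficient by coefficient. -/
theorem HasCoeffDerivAt.log (hF : HasCoeffDerivAt F F' t)
    (h1 : ∀ s, MvPowerSeries.constantCoeff (F s) = 1) :
    HasCoeffDerivAt (fun s => (PowerSeries.log ℝ).subst (F s - 1)) (F' * (F t)⁻¹) t := by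
  intro n
  set N := n.degree + 1 with hN
  have h0 : ∀ s, MvPowerSeries.constantCoeff (F s - 1) = 0 := fun s => by simp [h1]
  have hG : HasCoeffDerivAt (fun s => F s - 1) F' t := fun k => by
    simpa using (hF k).sub_const (MvPowerSeries.coeff k (1 : MvPowerSeries σ ℝ))
  have hlt : n.degree < N + 1 := by omega
  simp only [coeff_log_subst (h0 _) hlt]
  have hgeom : F' * (F t)⁻¹ = F' * ∑ m ∈ Finset.range N, (-(F t - 1)) ^ m +
      (-(F t - 1)) ^ N * (F' * (F t)⁻¹) := by
    have hinv : F t * (F t)⁻¹ = 1 := MvPowerSeries.mul_inv_cancel _ (by simp [h1])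
    have := mul_neg_geom_sum (-(F t - 1)) N
    rw [sub_neg_eq_add, add_sub_cancel] at this
    calc F' * (F t)⁻¹ = F' * (1 - (-(F t - 1)) ^ N) * (F t)⁻¹
          + (-(F t - 1)) ^ N * (F' * (F t)⁻¹) := by ring
      _ = F' * (∑ m ∈ Finset.range N, (-(F t - 1)) ^ m) * (F t * (F t)⁻¹)
          + (-(F t - 1)) ^ N * (F' * (F t)⁻¹) := by rw [← this]; ring
      _ = _ := by rw [hinv, mul_one]
  -- the remainder of the geometric series has no terms of degree at most `n.degree`
  have hrem : MvPowerSeries.coeff n ((-(F t - 1)) ^ N * (F' * (F t)⁻¹)) = 0 := by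
    classical
    rw [MvPowerSeries.coeff_mul]
    refine Finset.sum_eq_zero fun p hp => ?_
    rw [coeff_pow_eq_zero_of_degree_lt, zero_mul]
    · rw [map_neg, h0, neg_zero]
    · rw [← Finset.HasAntidiagonal.mem_antidiagonal.1 hp, map_add] at hN
      omega
  rw [hgeom, map_add, hrem, add_zero, Finset.mul_sum, map_sum]
  simp only [Finset.sum_range_succ']
  have hz : PowerSeries.coeff 0 (PowerSeries.log ℝ) = 0 := by simp
  simp only [hz, zero_mul, add_zero]
  refine HasDerivAt.fun_sum fun m _ => ?_
  refine ((hG.pow m n).const_mul (PowerSeries.coeff (m + 1) (PowerSeries.log ℝ))).congr_deriv ?_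
  have hm : (m : ℝ) + 1 ≠ 0 := by positivity
  have hneg : (-(F t - 1)) ^ m = MvPowerSeries.C ((-1 : ℝ) ^ m) * (F t - 1) ^ m := by
    rw [neg_pow]; simp
  rw [hneg, mul_left_comm, MvPowerSeries.coeff_C_mul, map_nsmul, PowerSeries.coeff_log,
    mul_comm F']
  simp only [Nat.add_eq_zero_iff, one_ne_zero, and_false, if_false, nsmul_eq_mul]
  simp
  field_simp
  ring

end FormalLog

/-! ### The coefficients of the partition series -/

section Combinatorics

variable {X : Type*}

/-- The occupation numbers of the configuration `x`: the number of particles at each site. -/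
noncomputable def occupation {k : ℕ} (x : Fin k → X) : X →₀ ℕ :=
  ∑ i, Finsupp.single (x i) 1

theorem occupation_apply [DecidableEq X] {k : ℕ} (x : Fin k → X) (y : X) :
    occupation x y = (Finset.univ.filter fun i => x i = y).card := by
  rw [Finset.card_filter, occupation, Finsupp.finsetSum_apply]
  exact Finset.sum_congr rfl fun i _ => Finsupp.single_apply

theorem degree_occupation {k : ℕ} (x : Fin k → X) : (occupation x).degree = k := by
  simp [occupation, map_sum]

theorem prod_pow_occupation [Fintype X] {M : Type*} [CommMonoid M] (f : X → M) {k : ℕ}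
    (x : Fin k → X) :
    ∏ y, f y ^ occupation x y = ∏ i, f (x i) := by
  classical
  rw [← Finset.prod_fiberwise_of_maps_to (g := x) (t := Finset.univ) (fun _ _ => Finset.mem_univ _)]
  refine Finset.prod_congr rfl fun y _ => ?_
  rw [occupation_apply, Finset.prod_congr rfl (g := fun _ => f y), Finset.prod_const]
  intro i hi
  rw [(Finset.mem_filter.1 hi).2]

/-- The number of pairs of particles on the unordered pair of sites `e`, for the occupation
numbers `n`. -/
def pairCount [DecidableEq X] (n : X →₀ ℕ) (e : Sym2 X) : ℕ :=
  Sym2.lift ⟨fun a b => if a = b then (n a).choose 2 else n a * n b, fun a b => by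
    by_cases h : a = b
    · subst h; rfl
    · simp [h, Ne.symm h, mul_comm]⟩ e

theorem pairCount_mk [DecidableEq X] (n : X →₀ ℕ) (a b : X) :
    pairCount n s(a, b) = if a = b then (n a).choose 2 else n a * n b := rfl

/-- The factor `1/2` which unordered pairs of particles at one site carry in `∂Z_W/∂W(a, b)`. -/
noncomputable def pairFactor [DecidableEq X] (a b : X) : ℝ := if a = b then 1 / 2 else 1

theorem pairFactor_nonneg [DecidableEq X] (a b : X) : 0 ≤ pairFactor a b := by
  unfold pairFactor; split_ifs <;> norm_num

variable [Fintype X]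

/-- The product `∏_x n_x!`. -/
def factorialProd (n : X →₀ ℕ) : ℕ := ∏ x, (n x).factorial

theorem factorialProd_ne_zero (n : X →₀ ℕ) : (factorialProd n : ℝ) ≠ 0 := by
  simp [factorialProd, Finset.prod_eq_zero_iff, Nat.factorial_ne_zero]

theorem factorialProd_mul_multinomial (n : X →₀ ℕ) :
    factorialProd n * n.multinomial = n.degree.factorial := by
  rw [Finsupp.multinomial_eq_of_support_subset (Finset.subset_univ n.support), factorialProd,
    Nat.multinomial_spec, Finsupp.degree_eq_sum]

variable [DecidableEq X]

/-- The number of pairs on `e` which a particle at the site `a` forms with the particles counted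
by `n`. -/
def newPairs (a : X) (n : X →₀ ℕ) (e : Sym2 X) : ℕ :=
  ∑ c, if e = s(a, c) then n c else 0

theorem newPairs_add_single (a b : X) (n : X →₀ ℕ) (e : Sym2 X) :
    newPairs a (n + Finsupp.single b 1) e = newPairs a n e + if e = s(a, b) then 1 else 0 := by
  have : ∀ c, (if e = s(a, c) then (n + Finsupp.single b 1 : X →₀ ℕ) c else 0) =
      (if e = s(a, c) then n c else 0) + if b = c then (if e = s(a, b) then 1 else 0) else 0 := by
    intro c
    by_cases hbc : b = c
    · subst hbc
      by_cases he : e = s(a, b) <;> simp [he]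
    · simp [hbc]
  simp only [newPairs, this, Finset.sum_add_distrib]
  simp

theorem prod_pow_newPairs (W : Sym2 X → ℝ) (a : X) (n : X →₀ ℕ) :
    ∏ e, W e ^ newPairs a n e = ∏ c, W s(a, c) ^ n c := by
  simp only [newPairs, ← Finset.prod_pow_eq_pow_sum]
  rw [Finset.prod_comm]
  refine Finset.prod_congr rfl fun c _ => ?_
  rw [Finset.prod_eq_single s(a, c)] <;> simp +contextual

theorem pairCount_add_single (a : X) (n : X →₀ ℕ) (e : Sym2 X) :
    pairCount (n + Finsupp.single a 1) e = pairCount n e + newPairs a n e := by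
  induction e using Sym2.ind with
  | _ c d =>
  have key : newPairs a n s(c, d) = if c = a then n d else if d = a then n c else 0 := by
    unfold newPairs
    by_cases hc : c = a
    · subst hc
      rw [Finset.sum_eq_single d] <;> simp +contextual [Ne.symm]
    · by_cases hd : d = a
      · subst hd
        rw [Finset.sum_eq_single c] <;> simp +contextual [Ne.symm, hc]
      · simp [hc, hd]
  rw [key, pairCount_mk, pairCount_mk]
  by_cases hcd : c = d
  · subst hcd
    by_cases hc : c = a
    · subst hc
      simp [Nat.choose_succ_succ' (n c) 1, add_comm ((n c).choose 2)]
    · simp [hc]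
  · by_cases hc : c = a
    · subst hc
      simp [hcd]
      ring
    · by_cases hd : d = a
      · subst hd
        simp [hc]
        ring
      · simp [hcd, hc, hd]

/-- The Boltzmann weight of any configuration with the occupation numbers `n`. -/
noncomputable def occupationWeight (W : Sym2 X → ℝ) (n : X →₀ ℕ) : ℝ :=
  ∏ e, W e ^ pairCount n e

theorem occupationWeight_add_single (W : Sym2 X → ℝ) (a : X) (n : X →₀ ℕ) :
    occupationWeight W (n + Finsupp.single a 1) =
      (∏ c, W s(a, c) ^ n c) * occupationWeight W n := by
  rw [← prod_pow_newPairs, occupationWeight, occupationWeight, ← Finset.prod_mul_distrib]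
  refine Finset.prod_congr rfl fun e _ => ?_
  rw [pairCount_add_single, pow_add, mul_comm]

theorem occupationWeight_zero (W : Sym2 X → ℝ) : occupationWeight W 0 = 1 := by
  refine Finset.prod_eq_one fun e _ => ?_
  induction e using Sym2.ind with
  | _ c d => simp [pairCount_mk]

/-- The pair weight depends on the occupation numbers only. -/
theorem pairWeight_eq_occupationWeight (W : Sym2 X → ℝ) {k : ℕ} (x : Fin k → X) :
    pairWeight W x = occupationWeight W (occupation x) := by
  induction k with
  | zero => simp [pairWeight, occupation, occupationWeight_zero]
  | succ k ih =>
    have hocc : occupation x = occupation (fun i => x (Fin.succ i)) + Finsupp.single (x 0) 1 := by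
      rw [occupation, Fin.sum_univ_succ, add_comm]
      rfl
    rw [hocc, occupationWeight_add_single, ← ih, prod_pow_occupation (fun c => W s(x 0, c))]
    simp [pairWeight, Fin.prod_univ_succ, Fin.prod_Ioi_succ]

/-- The number of configurations with given occupation numbers, read off from the expansion of
`(∑ x, X x) ^ |n|`. -/
theorem card_occupation_eq (n : X →₀ ℕ) :
    (Finset.univ.filter fun x : Fin n.degree → X => occupation x = n).card = n.multinomial := by
  have h := MvPolynomial.coeff_sum_X_pow_of_fintype (R := ℕ) n n.degree
  have hdeg : (n.sum fun _ m => m) = n.degree := by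
    simp [Finsupp.sum, Finsupp.degree_apply]
  rw [if_pos hdeg, ← Fin.prod_const, Finset.prod_univ_sum, MvPolynomial.coeff_sum] at h
  simp only [Fintype.piFinset_univ, Nat.cast_id] at h
  rw [← h, Finset.card_filter]
  refine Finset.sum_congr rfl fun x _ => ?_
  have : (∏ i, MvPolynomial.X (x i) : MvPolynomial X ℕ) =
      MvPolynomial.monomial (occupation x) 1 := by
    simp only [occupation, MvPolynomial.X]
    rw [MvPolynomial.monomial_sum_one]
  rw [this, MvPolynomial.coeff_monomial]

theorem factorialProd_add_single (a : X) (n : X →₀ ℕ) :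
    factorialProd (n + Finsupp.single a 1) = (n a + 1) * factorialProd n := by
  unfold factorialProd
  rw [← Finset.mul_prod_erase _ _ (Finset.mem_univ a),
    ← Finset.mul_prod_erase _ (fun x => (n x).factorial) (Finset.mem_univ a), ← mul_assoc]
  congr 1
  · simp [Nat.factorial_succ]
  · refine Finset.prod_congr rfl fun x hx => ?_
    simp [Ne.symm (Finset.ne_of_mem_erase hx)]

theorem coeff_partitionSeries_eq_sum (W : Sym2 X → ℝ) (n : X →₀ ℕ) :
    MvPowerSeries.coeff n (partitionSeries W) = (1 / (n.degree.factorial : ℝ)) *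
      ∑ x : Fin n.degree → X with occupation x = n, pairWeight W x := by
  change (1 / (n.degree.factorial : ℝ)) * _ = _
  congr 2
  ext x
  simp [Finsupp.ext_iff, occupation_apply]

/-- `Z_W = ∑_n (∏_e W(e)^(number of pairs on e)) w^n / ∏_x n_x!`. -/
theorem coeff_partitionSeries (W : Sym2 X → ℝ) (n : X →₀ ℕ) :
    MvPowerSeries.coeff n (partitionSeries W) = occupationWeight W n / factorialProd n := by
  have h : (factorialProd n : ℝ) * n.multinomial = n.degree.factorial := by
    exact_mod_cast factorialProd_mul_multinomial n
  rw [coeff_partitionSeries_eq_sum, Finset.sum_congr rfl (g := fun _ => occupationWeight W n),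
    Finset.sum_const, card_occupation_eq, nsmul_eq_mul, ← h]
  · have h1 := factorialProd_ne_zero n
    have h2 : (n.multinomial : ℝ) ≠ 0 := by
      intro h2
      rw [h2, mul_zero] at h
      exact n.degree.factorial_ne_zero (by exact_mod_cast h.symm)
    field_simp
  · intro x hx
    rw [pairWeight_eq_occupationWeight, (Finset.mem_filter.1 hx).2]

theorem constantCoeff_partitionSeries (W : Sym2 X → ℝ) :
    MvPowerSeries.constantCoeff (partitionSeries W) = 1 := by
  rw [← MvPowerSeries.coeff_zero_eq_constantCoeff_apply, coeff_partitionSeries,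
    occupationWeight_zero]
  simp [factorialProd]

/-- The factors by which the fugacities change in the presence of a particle at `a`. -/
def field (W : Sym2 X → ℝ) (a : X) : X → ℝ := fun c => W s(a, c)

/-- `w_a ∂Z_W/∂w_a = w_a Z_W(W(a, ·) w)`. -/
theorem coeff_partitionSeries_mul_apply (W : Sym2 X → ℝ) (a : X) (n : X →₀ ℕ) :
    (n a : ℝ) * MvPowerSeries.coeff n (partitionSeries W) =
      MvPowerSeries.coeff n (MvPowerSeries.monomial (Finsupp.single a 1) 1 *
        MvPowerSeries.rescale (field W a) (partitionSeries W)) := by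
  rw [MvPowerSeries.coeff_monomial_mul]
  split_ifs with h
  · obtain ⟨m, rfl⟩ := exists_add_of_le h
    rw [add_tsub_cancel_left, add_comm, MvPowerSeries.coeff_rescale, coeff_partitionSeries,
      coeff_partitionSeries, occupationWeight_add_single, factorialProd_add_single,
      Finsupp.prod_fintype _ _ (by simp)]
    have h1 := factorialProd_ne_zero m
    have h2 : (m a : ℝ) + 1 ≠ 0 := by positivity
    simp only [Finsupp.add_apply, Finsupp.single_eq_same, field]
    push_cast
    field_simp
  · have : n a = 0 := by
      by_contra h0
      exact h (by simpa [Finsupp.single_le_iff] using Nat.one_le_iff_ne_zero.2 h0)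
    simp [this]

theorem hasDerivAt_occupationWeight (W : Sym2 X → ℝ) (e : Sym2 X) (n : X →₀ ℕ) :
    HasDerivAt (fun t => occupationWeight (Function.update W e t) n)
      (pairCount n e * (W e ^ (pairCount n e - 1) *
        ∏ e' ∈ Finset.univ.erase e, W e' ^ pairCount n e')) (W e) := by
  have h : ∀ t, occupationWeight (Function.update W e t) n =
      t ^ pairCount n e * ∏ e' ∈ Finset.univ.erase e, W e' ^ pairCount n e' := by
    intro t
    rw [occupationWeight, ← Finset.mul_prod_erase _ _ (Finset.mem_univ e)]
    congr 1
    · simp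
    · refine Finset.prod_congr rfl fun e' he' => ?_
      rw [Function.update_of_ne (Finset.ne_of_mem_erase he')]
  simp only [h]
  exact ((hasDerivAt_pow _ _).mul_const _).congr_deriv (by ring)

/-- `∂Z_W/∂W(a, b) = w_a w_b Z_W(W(a, ·) W(b, ·) w)`, with an additional factor `1/2` if
`a = b`. -/
theorem hasCoeffDerivAt_partitionSeries (W : Sym2 X → ℝ) (a b : X) :
    HasCoeffDerivAt (fun t => partitionSeries (Function.update W s(a, b) t))
      (MvPowerSeries.monomial (Finsupp.single a 1 + Finsupp.single b 1) (pairFactor a b) *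
        MvPowerSeries.rescale (field W a * field W b) (partitionSeries W)) (W s(a, b)) := by
  intro n
  simp only [coeff_partitionSeries]
  refine ((hasDerivAt_occupationWeight W s(a, b) n).div_const _).congr_deriv ?_
  rw [MvPowerSeries.coeff_monomial_mul]
  split_ifs with h
  · obtain ⟨m, rfl⟩ := exists_add_of_le h
    rw [add_tsub_cancel_left]
    have hn : Finsupp.single a 1 + Finsupp.single b 1 + m =
        m + Finsupp.single b 1 + Finsupp.single a 1 := by abel
    rw [hn]
    -- the exponents of the weight after removing one factor `W s(a, b)`
    set E : Sym2 X → ℕ := fun e => pairCount m e + newPairs b m e + newPairs a m e with hE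
    have hcount : ∀ e, pairCount (m + Finsupp.single b 1 + Finsupp.single a 1) e =
        E e + if e = s(a, b) then 1 else 0 := by
      intro e
      rw [pairCount_add_single, pairCount_add_single, newPairs_add_single]
      simp only [hE]; ring
    have hprod : W s(a, b) ^ (pairCount (m + Finsupp.single b 1 + Finsupp.single a 1) s(a, b) - 1) *
        ∏ e' ∈ Finset.univ.erase s(a, b),
          W e' ^ pairCount (m + Finsupp.single b 1 + Finsupp.single a 1) e' =
        (∏ c, field W a c ^ m c) * (∏ c, field W b c ^ m c) * occupationWeight W m := by
      simp only [field]
      rw [← prod_pow_newPairs, ← prod_pow_newPairs, occupationWeight, ← Finset.prod_mul_distrib,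
        ← Finset.prod_mul_distrib, ← Finset.mul_prod_erase _ _ (Finset.mem_univ s(a, b))]
      congr 1
      · rw [hcount, if_pos rfl, Nat.add_sub_cancel, ← pow_add, ← pow_add]
        congr 1
        simp only [hE]; ring
      · refine Finset.prod_congr rfl fun e he => ?_
        rw [hcount, if_neg (Finset.ne_of_mem_erase he), ← pow_add, ← pow_add]
        congr 1
        simp only [hE]; ring
    have hN : (pairCount (m + Finsupp.single b 1 + Finsupp.single a 1) s(a, b) : ℝ) =
        pairFactor a b * (((m + Finsupp.single b 1 : X →₀ ℕ) a + 1) * (m b + 1)) := by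
      rw [pairCount_mk, pairFactor]
      split_ifs with hab
      · subst hab
        rw [Nat.cast_choose_two]
        simp
        ring
      · simp [hab, Ne.symm hab]
    rw [hprod, hN, factorialProd_add_single, factorialProd_add_single,
      MvPowerSeries.coeff_rescale, coeff_partitionSeries, Finsupp.prod_fintype _ _ (by simp)]
    have h1 := factorialProd_ne_zero m
    have h2 : (m b : ℝ) + 1 ≠ 0 := by positivity
    have h3 : ((m + Finsupp.single b 1 : X →₀ ℕ) a : ℝ) + 1 ≠ 0 := by positivity
    simp only [Pi.mul_apply, mul_pow, Finset.prod_mul_distrib]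
    push_cast at h3 ⊢
    field_simp
  · have h0 : pairCount n s(a, b) = 0 := by
      rw [pairCount_mk]
      by_contra h0
      refine h fun c => ?_
      split_ifs at h0 with hab
      · subst hab
        have : 2 ≤ n a := by
          by_contra h2
          exact h0 (Nat.choose_eq_zero_of_lt (by omega))
        by_cases hc : a = c
        · subst hc; simpa using this
        · simp [hc]
      · have h4 : n a ≠ 0 := fun h => h0 (by simp [h])
        have h5 : n b ≠ 0 := fun h => h0 (by simp [h])
        simp only [Finsupp.add_apply, Finsupp.single_apply]
        split_ifs with h6 h7 h7
        · exact absurd (h6.trans h7.symm) hab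
        · subst h6; omega
        · subst h7; omega
        · omega
    simp [h0]

end Combinatorics

/-! ### Differential identities for the Mayer series -/

section Euler

variable {σ : Type*}

/-- The Euler operator `∑_x w_x ∂/∂w_x` on formal power series. -/
noncomputable def euler (F : MvPowerSeries σ ℝ) : MvPowerSeries σ ℝ :=
  fun n => n.degree * MvPowerSeries.coeff n F

theorem coeff_euler (F : MvPowerSeries σ ℝ) (n : σ →₀ ℕ) :
    MvPowerSeries.coeff n (euler F) = n.degree * MvPowerSeries.coeff n F := rfl

theorem euler_mul (F G : MvPowerSeries σ ℝ) : euler (F * G) = euler F * G + F * euler G := by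
  classical
  ext n
  simp only [coeff_euler, map_add, MvPowerSeries.coeff_mul, Finset.mul_sum,
    ← Finset.sum_add_distrib]
  refine Finset.sum_congr rfl fun p hp => ?_
  rw [← Finset.HasAntidiagonal.mem_antidiagonal.1 hp, map_add]
  push_cast
  ring

theorem euler_rescale (V : σ → ℝ) (F : MvPowerSeries σ ℝ) :
    euler (MvPowerSeries.rescale V F) = MvPowerSeries.rescale V (euler F) := by
  ext n
  simp only [coeff_euler, MvPowerSeries.coeff_rescale]
  ring

theorem euler_log [Finite σ] {F : MvPowerSeries σ ℝ} (hF : MvPowerSeries.constantCoeff F = 1) :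
    euler ((PowerSeries.log ℝ).subst (F - 1)) = euler F * F⁻¹ := by
  -- differentiate the family `F (s w)` at `s = 1`
  have hscale : ∀ (H : MvPowerSeries σ ℝ) (n : σ →₀ ℕ) (s : ℝ),
      MvPowerSeries.coeff n (MvPowerSeries.rescale (fun _ => s) H) =
        s ^ n.degree * MvPowerSeries.coeff n H := by
    intro H n s
    rw [MvPowerSeries.coeff_rescale, Finsupp.prod, Finset.prod_pow_eq_pow_sum,
      Finsupp.degree_apply]
  have hderiv : ∀ H : MvPowerSeries σ ℝ,
      HasCoeffDerivAt (fun s => MvPowerSeries.rescale (fun _ => s) H) (euler H) 1 := by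
    intro H n
    simp only [hscale]
    exact ((hasDerivAt_pow _ _).mul_const _).congr_deriv (by simp [coeff_euler])
  have hone : MvPowerSeries.rescale (fun _ => (1 : ℝ)) F = F := by
    ext n; simp [hscale]
  have h1 : ∀ s : ℝ, MvPowerSeries.constantCoeff (MvPowerSeries.rescale (fun _ => s) F) = 1 := by
    intro s
    rw [← MvPowerSeries.coeff_zero_eq_constantCoeff_apply, hscale]
    simp [hF]
  have hlog := (hderiv F).log h1
  simp only [log_subst_rescale hF, hone] at hlog
  ext n
  exact (hderiv _ n).unique (hlog n)

end Euler

section Identities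

variable {X : Type*} [Fintype X] [DecidableEq X]

/-- The formal power series `log Z_W`. -/
noncomputable def mayerSeries (W : Sym2 X → ℝ) : MvPowerSeries X ℝ :=
  (PowerSeries.log ℝ).subst (partitionSeries W - 1)

theorem coeff_mayerSeries (W : Sym2 X → ℝ) (n : X →₀ ℕ) :
    MvPowerSeries.coeff n (mayerSeries W) = mayerCoeff n W := rfl

/-- The quotient `Z_W(V w) / Z_W(w)` as a formal power series. -/
noncomputable def partitionRatio (V : X → ℝ) (W : Sym2 X → ℝ) : MvPowerSeries X ℝ :=
  MvPowerSeries.rescale V (partitionSeries W) * (partitionSeries W)⁻¹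

theorem partitionSeries_mul_inv (W : Sym2 X → ℝ) :
    partitionSeries W * (partitionSeries W)⁻¹ = 1 :=
  MvPowerSeries.mul_inv_cancel _ (by simp [constantCoeff_partitionSeries])

theorem mayerCoeff_zero (W : Sym2 X → ℝ) : mayerCoeff 0 W = 0 := by
  rw [mayerCoeff, coeff_log_subst (N := 1) (by simp [constantCoeff_partitionSeries]) (by simp)]
  simp

theorem coeff_zero_partitionRatio (V : X → ℝ) (W : Sym2 X → ℝ) :
    MvPowerSeries.coeff 0 (partitionRatio V W) = 1 := by
  rw [partitionRatio, MvPowerSeries.coeff_zero_eq_constantCoeff_apply, map_mul,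
    MvPowerSeries.constantCoeff_inv, constantCoeff_partitionSeries,
    ← MvPowerSeries.coeff_zero_eq_constantCoeff_apply, MvPowerSeries.coeff_rescale]
  simp [constantCoeff_partitionSeries]

/-- `w_a ∂(log Z_W)/∂w_a = w_a Z_W(W(a, ·) w) / Z_W(w)`. -/
theorem apply_mul_mayerCoeff (W : Sym2 X → ℝ) (a : X) (n : X →₀ ℕ) :
    (n a : ℝ) * mayerCoeff n W = MvPowerSeries.coeff n
      (MvPowerSeries.monomial (Finsupp.single a 1) 1 * partitionRatio (field W a) W) := by
  -- differentiate with respect to a scaling of the single fugacity `w_a`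
  have hscale : ∀ (H : MvPowerSeries X ℝ) (n : X →₀ ℕ) (s : ℝ),
      MvPowerSeries.coeff n (MvPowerSeries.rescale (Function.update 1 a s) H) =
        s ^ n a * MvPowerSeries.coeff n H := by
    intro H n s
    rw [MvPowerSeries.coeff_rescale, Finsupp.prod_fintype _ _ (by simp),
      Finset.prod_eq_single a (fun b _ hb => by simp [hb]) (by simp)]
    simp
  have hderiv : HasCoeffDerivAt
      (fun s => MvPowerSeries.rescale (Function.update 1 a s) (partitionSeries W))
      (MvPowerSeries.monomial (Finsupp.single a 1) 1 *
        MvPowerSeries.rescale (field W a) (partitionSeries W)) 1 := by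
    intro n
    simp only [hscale]
    refine ((hasDerivAt_pow _ _).mul_const _).congr_deriv ?_
    simp [← coeff_partitionSeries_mul_apply]
  have h1 : ∀ s : ℝ, MvPowerSeries.constantCoeff
      (MvPowerSeries.rescale (Function.update 1 a s) (partitionSeries W)) = 1 := by
    intro s
    rw [← MvPowerSeries.coeff_zero_eq_constantCoeff_apply, hscale]
    simp [constantCoeff_partitionSeries]
  have hone : MvPowerSeries.rescale (Function.update 1 a (1 : ℝ)) (partitionSeries W) =
      partitionSeries W := by
    ext n; simp
  have hlog := hderiv.log h1 n
  simp only [log_subst_rescale (constantCoeff_partitionSeries W), hscale, hone, mul_assoc] at hlog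
  refine HasDerivAt.unique ?_ hlog
  exact ((hasDerivAt_pow _ _).mul_const _).congr_deriv (by simp [mayerCoeff])

/-- `∂(log Z_W)/∂W(a, b) = w_a w_b Z_W(W(a, ·) W(b, ·) w) / Z_W(w)`, with an additional factor
`1/2` if `a = b`. -/
theorem hasDerivAt_mayerCoeff (W : Sym2 X → ℝ) (a b : X) (n : X →₀ ℕ) :
    HasDerivAt (fun t => mayerCoeff n (Function.update W s(a, b) t))
      (MvPowerSeries.coeff n
        (MvPowerSeries.monomial (Finsupp.single a 1 + Finsupp.single b 1) (pairFactor a b) *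
          partitionRatio (field W a * field W b) W)) (W s(a, b)) := by
  have h := (hasCoeffDerivAt_partitionSeries W a b).log
    (fun _ => constantCoeff_partitionSeries _) n
  rwa [Function.update_eq_self, mul_assoc] at h

/-- The logarithmic derivative of `Z_W(V w) / Z_W(w)` along the Euler operator. -/
theorem euler_partitionRatio (V : X → ℝ) (W : Sym2 X → ℝ) :
    euler (partitionRatio V W) =
      (MvPowerSeries.rescale V (euler (mayerSeries W)) - euler (mayerSeries W)) *
        partitionRatio V W := by
  set Z := partitionSeries W with hZ
  set Q := partitionRatio V W with hQ
  have hinv : Z * Z⁻¹ = 1 := partitionSeries_mul_inv W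
  have hL : euler (mayerSeries W) = euler Z * Z⁻¹ :=
    euler_log (constantCoeff_partitionSeries W)
  have hEZ : euler Z = euler (mayerSeries W) * Z := by
    rw [hL, mul_assoc, mul_comm Z⁻¹, hinv, mul_one]
  have hQZ : Q * Z = MvPowerSeries.rescale V Z := by
    rw [hQ, partitionRatio, ← hZ, mul_assoc, mul_comm Z⁻¹, hinv, mul_one]
  have h := congrArg euler hQZ
  rw [euler_mul, euler_rescale, hEZ, map_mul, ← hQZ] at h
  calc euler Q = euler Q * Z * Z⁻¹ := by rw [mul_assoc, hinv, mul_one]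
    _ = (MvPowerSeries.rescale V (euler (mayerSeries W)) - euler (mayerSeries W)) * Q *
          (Z * Z⁻¹) := by linear_combination Z⁻¹ * h
    _ = _ := by rw [hinv, mul_one]

end Identities

/-! ### Alternating signs and monotonicity -/

section Signs

variable {X : Type*}

theorem IsRepulsive.field_nonneg {W : Sym2 X → ℝ} (hW : IsRepulsive W) (a : X) :
    0 ≤ field W a := fun c => (hW a c).1

theorem IsRepulsive.field_le_one {W : Sym2 X → ℝ} (hW : IsRepulsive W) (a : X) :
    field W a ≤ 1 := fun c => (hW a c).2

theorem IsRepulsive.update [DecidableEq X] {W : Sym2 X → ℝ} (hW : IsRepulsive W) (e : Sym2 X)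
    {t : ℝ}
    (ht : t ∈ Set.Icc (0 : ℝ) 1) : IsRepulsive (Function.update W e t) := by
  intro x y
  by_cases h : s(x, y) = e
  · subst h; simpa using ht
  · simpa [Function.update_of_ne h] using hW x y

theorem IsRepulsive.pair_bounds {W W' : Sym2 X → ℝ} (hW : IsRepulsive W) (hW' : IsRepulsive W')
    (hle : W ≤ W') (a b : X) : 0 ≤ field W a * field W b ∧
      field W a * field W b ≤ field W' a * field W' b ∧ field W' a * field W' b ≤ 1 := by
  refine ⟨fun c => mul_nonneg (hW a c).1 (hW b c).1, fun c => ?_, fun c => ?_⟩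
  · exact mul_le_mul (hle _) (hle _) (hW b c).1 (hW' a c).1
  · exact mul_le_one₀ (hW' a c).2 (hW' b c).1 (hW' b c).2

variable [Fintype X] [DecidableEq X]

/-- The Mayer coefficient with the alternating sign removed, `(-1)^(|n| - 1) c_n(W)`. -/
noncomputable def signedMayerCoeff (n : X →₀ ℕ) (W : Sym2 X → ℝ) : ℝ :=
  (-1) ^ (n.degree + 1) * mayerCoeff n W

/-- The coefficient of `w^n` in `Z_W(-V w) / Z_W(-w)`. -/
noncomputable def signedRatioCoeff (n : X →₀ ℕ) (V : X → ℝ) (W : Sym2 X → ℝ) : ℝ :=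
  (-1) ^ n.degree * MvPowerSeries.coeff n (partitionRatio V W)

/-- The recursion for the coefficients of `Z_W(-V w) / Z_W(-w)`; if `0 ≤ V ≤ 1`, all factors on
the right-hand side turn out to be nonnegative. -/
theorem degree_mul_signedRatioCoeff (n : X →₀ ℕ) (V : X → ℝ) (W : Sym2 X → ℝ) :
    n.degree * signedRatioCoeff n V W = ∑ p ∈ Finset.HasAntidiagonal.antidiagonal n,
      p.1.degree * (signedMayerCoeff p.1 W * (1 - ∏ x, V x ^ p.1 x)) *
        signedRatioCoeff p.2 V W := by
  rw [signedRatioCoeff, mul_left_comm, ← coeff_euler, euler_partitionRatio,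
    MvPowerSeries.coeff_mul, Finset.mul_sum]
  refine Finset.sum_congr rfl fun p hp => ?_
  rw [← Finset.HasAntidiagonal.mem_antidiagonal.1 hp, map_add, map_sub, coeff_euler,
    MvPowerSeries.coeff_rescale, coeff_euler, coeff_mayerSeries, signedMayerCoeff,
    signedRatioCoeff, Finsupp.prod_fintype _ _ (by simp)]
  ring

theorem apply_mul_signedMayerCoeff (a : X) (n : X →₀ ℕ) (W : Sym2 X → ℝ) :
    ((n + Finsupp.single a 1 : X →₀ ℕ) a : ℝ) *
      signedMayerCoeff (n + Finsupp.single a 1) W = signedRatioCoeff n (field W a) W := by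
  rw [signedMayerCoeff, mul_left_comm, apply_mul_mayerCoeff, add_comm n,
    MvPowerSeries.coeff_add_monomial_mul, signedRatioCoeff]
  simp [pow_add]

/-- The inductive step for the ratios: in degree at most `d` they inherit sign and monotonicity
from the Mayer coefficients of degree at most `d`. -/
theorem signedRatioCoeff_antitone_of_degree_le {W W' : Sym2 X → ℝ} {d : ℕ}
    (hA : ∀ n : X →₀ ℕ, n.degree ≤ d →
      0 ≤ signedMayerCoeff n W' ∧ signedMayerCoeff n W' ≤ signedMayerCoeff n W)
    {V V' : X → ℝ} (h0 : 0 ≤ V) (hV : V ≤ V') (h1 : V' ≤ 1) (n : X →₀ ℕ) (hn : n.degree ≤ d) :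
    0 ≤ signedRatioCoeff n V' W' ∧ signedRatioCoeff n V' W' ≤ signedRatioCoeff n V W := by
  induction hk : n.degree using Nat.strong_induction_on generalizing n with
  | _ k ih =>
  rcases Nat.eq_zero_or_pos k with hk0 | hk0
  · obtain rfl : n = 0 := (Finsupp.degree_eq_zero_iff n).1 (hk.trans hk0)
    simp [signedRatioCoeff, coeff_zero_partitionRatio]
  have hpow : ∀ m : X →₀ ℕ, 0 ≤ 1 - ∏ x, V' x ^ m x ∧
      1 - ∏ x, V' x ^ m x ≤ 1 - ∏ x, V x ^ m x := by
    intro m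
    have hle : ∏ x, V x ^ m x ≤ ∏ x, V' x ^ m x :=
      Finset.prod_le_prod (fun x _ => pow_nonneg (h0 x) _)
        fun x _ => pow_le_pow_left₀ (h0 x) (hV x) _
    have hle1 : ∏ x, V' x ^ m x ≤ 1 :=
      Finset.prod_le_one (fun x _ => pow_nonneg ((h0 x).trans (hV x)) _)
        fun x _ => pow_le_one₀ ((h0 x).trans (hV x)) (h1 x)
    constructor <;> linarith
  have hterm : ∀ p ∈ Finset.HasAntidiagonal.antidiagonal n,
      0 ≤ p.1.degree * (signedMayerCoeff p.1 W' * (1 - ∏ x, V' x ^ p.1 x)) *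
        signedRatioCoeff p.2 V' W' ∧
      p.1.degree * (signedMayerCoeff p.1 W' * (1 - ∏ x, V' x ^ p.1 x)) *
        signedRatioCoeff p.2 V' W' ≤
      p.1.degree * (signedMayerCoeff p.1 W * (1 - ∏ x, V x ^ p.1 x)) *
        signedRatioCoeff p.2 V W := by
    intro p hp
    have hdeg : p.1.degree + p.2.degree = n.degree := by
      rw [← Finset.HasAntidiagonal.mem_antidiagonal.1 hp, map_add]
    -- the terms with `p.1 = 0` vanish, all others involve the ratio in lower degree only
    rcases Nat.eq_zero_or_pos p.1.degree with hp0 | hp0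
    · simp [hp0]
    · obtain ⟨hA0, hA1⟩ := hA p.1 (by omega)
      obtain ⟨hB0, hB1⟩ := ih p.2.degree (by omega) p.2 (by omega) rfl
      obtain ⟨hP0, hP1⟩ := hpow p.1
      have hmul := mul_le_mul hA1 hP1 hP0 (hA0.trans hA1)
      constructor
      · positivity
      · exact mul_le_mul (mul_le_mul_of_nonneg_left hmul (Nat.cast_nonneg _)) hB1 hB0
          (mul_nonneg (Nat.cast_nonneg _) ((mul_nonneg hA0 hP0).trans hmul))
  have hpos : (0 : ℝ) < n.degree := by rw [hk]; exact_mod_cast hk0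
  constructor
  · refine (mul_nonneg_iff_of_pos_left hpos).1 ?_
    rw [degree_mul_signedRatioCoeff]
    exact Finset.sum_nonneg fun p hp => (hterm p hp).1
  · refine le_of_mul_le_mul_left ?_ hpos
    rw [degree_mul_signedRatioCoeff, degree_mul_signedRatioCoeff]
    exact Finset.sum_le_sum fun p hp => (hterm p hp).2

/-- For a repulsive gas the Mayer coefficients alternate in sign, and their absolute values
decrease in the Boltzmann factors. -/
theorem signedMayerCoeff_antitone {W W' : Sym2 X → ℝ} (hW : IsRepulsive W)
    (hW' : IsRepulsive W') (hle : W ≤ W') (n : X →₀ ℕ) :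
    0 ≤ signedMayerCoeff n W' ∧ signedMayerCoeff n W' ≤ signedMayerCoeff n W := by
  suffices H : ∀ d, ∀ n : X →₀ ℕ, n.degree ≤ d →
      0 ≤ signedMayerCoeff n W' ∧ signedMayerCoeff n W' ≤ signedMayerCoeff n W from
    H n.degree n le_rfl
  intro d
  induction d with
  | zero =>
    intro n hn
    obtain rfl : n = 0 := (Finsupp.degree_eq_zero_iff n).1 (by omega)
    simp [signedMayerCoeff, mayerCoeff_zero]
  | succ d ih =>
    intro n hn
    by_cases hn0 : n = 0
    · subst hn0
      exact ih 0 (by simp)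
    obtain ⟨a, ha⟩ := Finsupp.ne_iff.1 hn0
    have hle1 : Finsupp.single a 1 ≤ n := by
      simpa [Finsupp.single_le_iff] using Nat.one_le_iff_ne_zero.2 ha
    obtain ⟨m, rfl⟩ := exists_add_of_le hle1
    rw [add_comm] at hn ⊢
    have hm : m.degree ≤ d := by simpa using hn
    obtain ⟨hB0, hB1⟩ := signedRatioCoeff_antitone_of_degree_le ih (hW.field_nonneg a)
      (fun c => hle s(a, c)) (hW'.field_le_one a) m hm
    have hpos : (0 : ℝ) < (m + Finsupp.single a 1 : X →₀ ℕ) a := by simp; positivity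
    constructor
    · refine (mul_nonneg_iff_of_pos_left hpos).1 ?_
      rwa [apply_mul_signedMayerCoeff]
    · refine le_of_mul_le_mul_left ?_ hpos
      rwa [apply_mul_signedMayerCoeff, apply_mul_signedMayerCoeff]

theorem signedRatioCoeff_antitone {W W' : Sym2 X → ℝ} (hW : IsRepulsive W)
    (hW' : IsRepulsive W') (hle : W ≤ W') {V V' : X → ℝ} (h0 : 0 ≤ V) (hV : V ≤ V')
    (h1 : V' ≤ 1) (n : X →₀ ℕ) :
    0 ≤ signedRatioCoeff n V' W' ∧ signedRatioCoeff n V' W' ≤ signedRatioCoeff n V W :=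
  signedRatioCoeff_antitone_of_degree_le
    (fun m _ => signedMayerCoeff_antitone hW hW' hle m) h0 hV h1 n le_rfl

/-- `∂c_n/∂W(a, b)` as a coefficient of `Z_W(W(a, ·) W(b, ·) w) / Z_W(w)`. -/
theorem neg_one_pow_mul_partialDeriv_mayerCoeff (W : Sym2 X → ℝ) (a b : X) (n : X →₀ ℕ) :
    (-1) ^ (n.degree + 1) * partialDeriv s(a, b) (mayerCoeff n) W =
      if Finsupp.single a 1 + Finsupp.single b 1 ≤ n then
        -(pairFactor a b * signedRatioCoeff (n - (Finsupp.single a 1 + Finsupp.single b 1))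
          (field W a * field W b) W)
      else 0 := by
  rw [partialDeriv, (hasDerivAt_mayerCoeff W a b n).deriv, MvPowerSeries.coeff_monomial_mul]
  split_ifs with h
  · obtain ⟨m, rfl⟩ := exists_add_of_le h
    rw [add_tsub_cancel_left, signedRatioCoeff]
    simp [pow_add]
    ring
  · simp

theorem neg_one_pow_mul_partialDeriv_nonpos {W : Sym2 X → ℝ} (hW : IsRepulsive W) (a b : X)
    (n : X →₀ ℕ) : (-1) ^ (n.degree + 1) * partialDeriv s(a, b) (mayerCoeff n) W ≤ 0 := by
  rw [neg_one_pow_mul_partialDeriv_mayerCoeff]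
  split_ifs with h
  · obtain ⟨h0, -, h1⟩ := hW.pair_bounds hW le_rfl a b
    exact neg_nonpos.2 (mul_nonneg (pairFactor_nonneg a b)
      (signedRatioCoeff_antitone hW hW le_rfl h0 le_rfl h1 _).1)
  · exact le_rfl

/-- The partial derivatives of the Mayer coefficients are monotone in the Boltzmann factors. -/
theorem neg_one_pow_mul_partialDeriv_mono {W W' : Sym2 X → ℝ} (hW : IsRepulsive W)
    (hW' : IsRepulsive W') (hle : W ≤ W') (a b : X) (n : X →₀ ℕ) :
    (-1) ^ (n.degree + 1) * partialDeriv s(a, b) (mayerCoeff n) W ≤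
      (-1) ^ (n.degree + 1) * partialDeriv s(a, b) (mayerCoeff n) W' := by
  rw [neg_one_pow_mul_partialDeriv_mayerCoeff, neg_one_pow_mul_partialDeriv_mayerCoeff]
  split_ifs with h
  · obtain ⟨h0, hV, h1⟩ := hW.pair_bounds hW' hle a b
    exact neg_le_neg (mul_le_mul_of_nonneg_left
      (signedRatioCoeff_antitone hW hW' hle h0 hV h1 _).2 (pairFactor_nonneg a b))
  · exact le_rfl

theorem deriv_nonneg_of_monotoneOn_Icc {f : ℝ → ℝ} {t : ℝ}
    (hf : MonotoneOn f (Set.Icc 0 1)) (ht : t ∈ Set.Icc (0 : ℝ) 1) : 0 ≤ deriv f t := by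
  -- where `f` is not differentiable, `deriv f t` is `0`
  by_cases hd : DifferentiableAt ℝ f t
  · rw [← hd.derivWithin (uniqueDiffOn_Icc zero_lt_one t ht)]
    exact hf.derivWithin_nonneg
  · exact (deriv_zero_of_not_differentiableAt hd).ge

theorem neg_one_pow_mul_partialDeriv_partialDeriv_nonneg {W : Sym2 X → ℝ} (hW : IsRepulsive W)
    (x y a b : X) (n : X →₀ ℕ) : 0 ≤ (-1) ^ (n.degree + 1) *
      partialDeriv s(x, y) (partialDeriv s(a, b) (mayerCoeff n)) W := by
  rw [partialDeriv, ← deriv_const_mul_field]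
  refine deriv_nonneg_of_monotoneOn_Icc (fun s hs t ht hst => ?_) (hW x y)
  refine neg_one_pow_mul_partialDeriv_mono (hW.update _ hs) (hW.update _ ht) ?_ a b n
  exact Function.update_mono hst

end Signs

/-! ### Evaluation of formal power series and convergence -/

section Evaluation

variable {X : Type*} [Fintype X]

/-- The term of degree `n` of the formal power series `F` at the point `w`. -/
noncomputable def termAt (F : MvPowerSeries X ℝ) (w : X → ℂ) (n : X →₀ ℕ) : ℂ :=
  ((MvPowerSeries.coeff n F : ℝ) : ℂ) * ∏ x, w x ^ n x

theorem termAt_one (w : X → ℂ) (n : X →₀ ℕ) :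
    termAt 1 w n = if n = 0 then 1 else 0 := by
  classical
  rw [termAt, MvPowerSeries.coeff_one]
  split_ifs with h
  · subst h; simp
  · simp

theorem termAt_sub (F G : MvPowerSeries X ℝ) (w : X → ℂ) (n : X →₀ ℕ) :
    termAt (F - G) w n = termAt F w n - termAt G w n := by
  simp [termAt, sub_mul]

theorem hasSum_ite_eq_zero {M : Type*} [AddCommMonoid M] [TopologicalSpace M] (c : M) :
    HasSum (fun n : X →₀ ℕ => if n = 0 then c else 0) c := by
  simpa using hasSum_single (f := fun n : X →₀ ℕ => if n = 0 then c else 0) 0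
    (by simp +contextual)

theorem termAt_mul [DecidableEq X] (F G : MvPowerSeries X ℝ) (w : X → ℂ) (n : X →₀ ℕ) :
    termAt (F * G) w n =
      ∑ p ∈ Finset.HasAntidiagonal.antidiagonal n, termAt F w p.1 * termAt G w p.2 := by
  rw [termAt, MvPowerSeries.coeff_mul, Complex.ofReal_sum, Finset.sum_mul]
  refine Finset.sum_congr rfl fun p hp => ?_
  rw [← Finset.HasAntidiagonal.mem_antidiagonal.1 hp, termAt, termAt]
  simp only [Finsupp.add_apply, pow_add, Finset.prod_mul_distrib, Complex.ofReal_mul]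
  ring

/-- The series `F` converges absolutely at `w` to `z`, and the norms of its terms add up to at
most `r`. -/
structure EvaluatesTo (F : MvPowerSeries X ℝ) (w : X → ℂ) (z : ℂ) (r : ℝ) : Prop where
  summable : Summable fun n => ‖termAt F w n‖
  tsum_eq : ∑' n, termAt F w n = z
  tsum_norm_le : ∑' n, ‖termAt F w n‖ ≤ r

variable {F G : MvPowerSeries X ℝ} {w : X → ℂ} {z z' : ℂ} {r r' : ℝ}

theorem EvaluatesTo.nonneg (hF : EvaluatesTo F w z r) : 0 ≤ r :=
  (tsum_nonneg fun _ => norm_nonneg _).trans hF.tsum_norm_le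

theorem EvaluatesTo.hasSum (hF : EvaluatesTo F w z r) : HasSum (termAt F w) z := by
  have := hF.summable.of_norm.hasSum
  rwa [hF.tsum_eq] at this

theorem EvaluatesTo.norm_le (hF : EvaluatesTo F w z r) : ‖z‖ ≤ r := by
  rw [← hF.tsum_eq]
  exact (norm_tsum_le_tsum_norm hF.summable).trans hF.tsum_norm_le

theorem EvaluatesTo.one : EvaluatesTo (1 : MvPowerSeries X ℝ) w 1 1 := by
  have h : (fun n => ‖termAt (1 : MvPowerSeries X ℝ) w n‖) = fun n => if n = 0 then 1 else 0 := by
    ext n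
    rw [termAt_one]
    split_ifs <;> simp
  refine ⟨?_, ?_, ?_⟩
  · rw [h]
    exact (hasSum_ite_eq_zero (1 : ℝ)).summable
  · simp only [termAt_one]
    exact (hasSum_ite_eq_zero (1 : ℂ)).tsum_eq
  · rw [h, (hasSum_ite_eq_zero (1 : ℝ)).tsum_eq]

theorem EvaluatesTo.mul [DecidableEq X] (hF : EvaluatesTo F w z r) (hG : EvaluatesTo G w z' r') :
    EvaluatesTo (F * G) w (z * z') (r * r') := by
  set f : (X →₀ ℕ) → ℝ := fun n => ‖termAt F w n‖
  set g : (X →₀ ℕ) → ℝ := fun n => ‖termAt G w n‖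
  have hprod := summable_mul_of_summable_norm hF.summable hG.summable
  have hprod' : Summable fun p : (X →₀ ℕ) × (X →₀ ℕ) => f p.1 * g p.2 := by
    simpa using hprod.norm
  have hle : ∀ n, ‖termAt (F * G) w n‖ ≤
      ∑ p ∈ Finset.HasAntidiagonal.antidiagonal n, f p.1 * g p.2 := by
    intro n
    rw [termAt_mul]
    refine (norm_sum_le _ _).trans_eq (Finset.sum_congr rfl fun p _ => norm_mul _ _)
  have hsum := summable_sum_mul_antidiagonal_of_summable_mul (f := f) (g := g) hprod'
  have hs : Summable fun n => ‖termAt (F * G) w n‖ :=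
    Summable.of_nonneg_of_le (fun _ => norm_nonneg _) hle hsum
  refine ⟨hs, ?_, ?_⟩
  · have h := Summable.tsum_mul_tsum_eq_tsum_sum_antidiagonal (f := termAt F w)
      (g := termAt G w) hF.summable.of_norm hG.summable.of_norm hprod
    rw [tsum_congr (termAt_mul F G w), ← h, hF.tsum_eq, hG.tsum_eq]
  · refine (hs.tsum_le_tsum hle hsum).trans ?_
    rw [← Summable.tsum_mul_tsum_eq_tsum_sum_antidiagonal (f := f) (g := g) hF.summable
      hG.summable hprod']
    exact mul_le_mul hF.tsum_norm_le hG.tsum_norm_le (tsum_nonneg fun _ => norm_nonneg _)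
      hF.nonneg

theorem EvaluatesTo.pow (hF : EvaluatesTo F w z r) (m : ℕ) :
    EvaluatesTo (F ^ m) w (z ^ m) (r ^ m) := by
  classical
  induction m with
  | zero => simpa using EvaluatesTo.one
  | succ m ih => simpa only [pow_succ] using ih.mul hF

theorem EvaluatesTo.sub_one (hF : EvaluatesTo F w z r)
    (h1 : MvPowerSeries.constantCoeff F = 1) : EvaluatesTo (F - 1) w (z - 1) (r - 1) := by
  have h0 : termAt F w 0 = 1 := by simp [termAt, h1]
  have h : (fun n => ‖termAt (F - 1) w n‖) =
      fun n => ‖termAt F w n‖ - if n = 0 then 1 else 0 := by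
    ext n
    rw [termAt_sub, termAt_one]
    split_ifs with hn
    · subst hn; simp [h0]
    · simp
  have hn := hF.summable.hasSum.sub (hasSum_ite_eq_zero (1 : ℝ))
  refine ⟨?_, ?_, ?_⟩
  · rw [h]; exact hn.summable
  · simp only [termAt_sub, termAt_one]
    exact (hF.hasSum.sub (hasSum_ite_eq_zero (1 : ℂ))).tsum_eq
  · rw [h, hn.tsum_eq]
    exact sub_le_sub_right hF.tsum_norm_le 1

/-- If the terms of `F - 1` at `w` have total norm less than `1`, then the formal logarithm of `F`
converges at `w` to the principal branch of `log F(w)`. -/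
theorem EvaluatesTo.hasSum_log (hF : EvaluatesTo F w z r)
    (h1 : MvPowerSeries.constantCoeff F = 1) (hr : r < 2) :
    HasSum (termAt ((PowerSeries.log ℝ).subst (F - 1)) w) (Complex.log z) := by
  have hG := hF.sub_one h1
  have hr1 : r - 1 < 1 := by linarith
  set f : ℕ × (X →₀ ℕ) → ℂ := fun p =>
    ((PowerSeries.coeff p.1 (PowerSeries.log ℝ) : ℝ) : ℂ) * termAt ((F - 1) ^ p.1) w p.2 with hf
  have hcoeff : ∀ m, PowerSeries.coeff m (PowerSeries.log ℝ) = (-1) ^ (m + 1) / m := by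
    intro m
    rw [PowerSeries.coeff_log]
    split_ifs with hm
    · simp [hm]
    · simp
  have hcoeff_le : ∀ m, ‖((PowerSeries.coeff m (PowerSeries.log ℝ) : ℝ) : ℂ)‖ ≤ 1 := by
    intro m
    rw [hcoeff, Complex.norm_real, norm_div, norm_pow, norm_neg, norm_one, one_pow,
      Real.norm_natCast]
    rcases Nat.eq_zero_or_pos m with rfl | hm
    · simp
    · exact div_le_one_of_le₀ (by exact_mod_cast hm) (by positivity)
  have hrow : ∀ m, Summable fun n => ‖f (m, n)‖ := by
    intro m
    simp only [hf, norm_mul]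
    exact (hG.pow m).summable.mul_left _
  have hsum : Summable f := by
    refine Summable.of_norm ((summable_prod_of_nonneg fun _ => norm_nonneg _).2 ⟨hrow, ?_⟩)
    refine Summable.of_nonneg_of_le (fun _ => tsum_nonneg fun _ => norm_nonneg _) (fun m => ?_)
      (summable_geometric_of_lt_one hG.nonneg hr1)
    simp only [hf, norm_mul, tsum_mul_left]
    refine (mul_le_mul (hcoeff_le m) (hG.pow m).tsum_norm_le
      (tsum_nonneg fun _ => norm_nonneg _) zero_le_one).trans_eq (one_mul _)
  -- summing first over the exponents gives the Taylor series of the logarithm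
  have hlog : ∑' p, f p = Complex.log z := by
    have hrows := hsum.hasSum.prod_fiberwise fun m => (hG.pow m).hasSum.mul_left
      ((PowerSeries.coeff m (PowerSeries.log ℝ) : ℝ) : ℂ)
    have htaylor := Complex.hasSum_taylorSeries_log (hG.norm_le.trans_lt hr1)
    rw [add_sub_cancel] at htaylor
    refine hrows.unique (htaylor.congr_fun ?_)
    intro m
    rw [hcoeff]
    push_cast
    ring
  -- summing first over the powers gives the formal logarithm
  have hcols := (((Equiv.prodComm _ _).hasSum_iff.2 hsum.hasSum).prod_fiberwise
    (f := f ∘ Equiv.prodComm _ _) (g := termAt ((PowerSeries.log ℝ).subst (F - 1)) w)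
    fun n => ?_)
  · rwa [hlog] at hcols
  · have h0 : MvPowerSeries.constantCoeff (F - 1) = 0 := by simp [h1]
    have hval : termAt ((PowerSeries.log ℝ).subst (F - 1)) w n =
        ∑ m ∈ Finset.range (n.degree + 1), f (m, n) := by
      rw [termAt, coeff_log_subst h0 n.degree.lt_succ_self, Complex.ofReal_sum, Finset.sum_mul]
      refine Finset.sum_congr rfl fun m _ => ?_
      simp only [hf, termAt, Complex.ofReal_mul]
      ring
    rw [hval]
    refine hasSum_sum_of_ne_finset_zero fun m hm => ?_
    have hm' : n.degree < m := by simpa [Nat.lt_succ_iff] using hm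
    simp [hf, termAt, coeff_pow_eq_zero_of_degree_lt h0 hm']

end Evaluation

section PartitionFunction

variable {X : Type*}

theorem IsRepulsive.norm_pairWeight_le {W : Sym2 X → ℝ} (hW : IsRepulsive W) {k : ℕ}
    (x : Fin k → X) : ‖(pairWeight W x : ℂ)‖ ≤ 1 := by
  have h0 : 0 ≤ pairWeight W x :=
    Finset.prod_nonneg fun i _ => Finset.prod_nonneg fun j _ => (hW _ _).1
  rw [Complex.norm_real, Real.norm_of_nonneg h0]
  exact Finset.prod_le_one (fun i _ => Finset.prod_nonneg fun j _ => (hW _ _).1)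
    fun i _ => Finset.prod_le_one (fun j _ => (hW _ _).1) fun j _ => (hW _ _).2

variable [Fintype X] [DecidableEq X]

theorem sum_configurations_eq {M : Type*} [AddCommMonoid M] (k : ℕ) (f : (Fin k → X) → M) :
    ∑ x, f x = ∑ n ∈ Finset.univ.finsuppAntidiag k,
      ∑ x : Fin k → X with occupation x = n, f x := by
  refine (Finset.sum_fiberwise_of_maps_to (fun x _ => ?_) f).symm
  rw [Finset.mem_finsuppAntidiag, ← Finsupp.degree_eq_sum, degree_occupation]
  exact ⟨rfl, Finset.subset_univ _⟩

theorem mem_finsuppAntidiag_univ {n : X →₀ ℕ} {k : ℕ} :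
    n ∈ Finset.univ.finsuppAntidiag k ↔ n.degree = k := by
  rw [Finset.mem_finsuppAntidiag, ← Finsupp.degree_eq_sum]
  simp

theorem termAt_partitionSeries (W : Sym2 X → ℝ) (w : X → ℂ) (n : X →₀ ℕ) :
    termAt (partitionSeries W) w n = (1 / (n.degree.factorial : ℂ)) *
      ∑ x : Fin n.degree → X with occupation x = n, (∏ i, w (x i)) * (pairWeight W x : ℂ) := by
  rw [termAt, coeff_partitionSeries_eq_sum]
  push_cast
  rw [mul_assoc, Finset.sum_mul]
  congr 1
  refine Finset.sum_congr rfl fun x hx => ?_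
  rw [← prod_pow_occupation w x, (Finset.mem_filter.1 hx).2, mul_comm]

theorem sum_termAt_partitionSeries (W : Sym2 X → ℝ) (w : X → ℂ) (k : ℕ) :
    ∑ n ∈ Finset.univ.finsuppAntidiag k, termAt (partitionSeries W) w n =
      partitionTerm W w k := by
  rw [partitionTerm, sum_configurations_eq, Finset.mul_sum]
  refine Finset.sum_congr rfl fun n hn => ?_
  obtain rfl := mem_finsuppAntidiag_univ.1 hn
  exact termAt_partitionSeries W w n

theorem IsRepulsive.sum_norm_termAt_le {W : Sym2 X → ℝ} (hW : IsRepulsive W) (w : X → ℂ)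
    (k : ℕ) : ∑ n ∈ Finset.univ.finsuppAntidiag k, ‖termAt (partitionSeries W) w n‖ ≤
      (∑ x, ‖w x‖) ^ k / k.factorial := by
  rw [← Fin.prod_const, Finset.prod_univ_sum, Fintype.piFinset_univ, sum_configurations_eq,
    Finset.sum_div]
  refine Finset.sum_le_sum fun n hn => ?_
  obtain rfl := mem_finsuppAntidiag_univ.1 hn
  rw [termAt_partitionSeries, norm_mul, norm_div, norm_one, Complex.norm_natCast, one_div,
    div_eq_inv_mul]
  gcongr
  refine (norm_sum_le _ _).trans (Finset.sum_le_sum fun x _ => ?_)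
  rw [norm_mul, norm_prod]
  exact mul_le_of_le_one_right (Finset.prod_nonneg fun _ _ => norm_nonneg _)
    (hW.norm_pairWeight_le x)

theorem IsRepulsive.evaluatesTo_partitionFunction {W : Sym2 X → ℝ} (hW : IsRepulsive W)
    (w : X → ℂ) : EvaluatesTo (partitionSeries W) w (partitionFunction W w)
      (Real.exp (∑ x, ‖w x‖)) := by
  have hs : 0 ≤ ∑ x, ‖w x‖ := Finset.sum_nonneg fun _ _ => norm_nonneg _
  have hle : ∀ u : Finset (X →₀ ℕ), ∑ n ∈ u, ‖termAt (partitionSeries W) w n‖ ≤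
      Real.exp (∑ x, ‖w x‖) := by
    intro u
    set K := u.sup Finsupp.degree + 1 with hK
    calc ∑ n ∈ u, ‖termAt (partitionSeries W) w n‖
        = ∑ k ∈ Finset.range K, ∑ n ∈ u with n.degree = k,
            ‖termAt (partitionSeries W) w n‖ := by
          refine (Finset.sum_fiberwise_of_maps_to (fun n hn => ?_) _).symm
          exact Finset.mem_range.2 (Nat.lt_succ_of_le (Finset.le_sup hn))
      _ ≤ ∑ k ∈ Finset.range K, (∑ x, ‖w x‖) ^ k / k.factorial := by
          refine Finset.sum_le_sum fun k _ => le_trans ?_ (hW.sum_norm_termAt_le w k)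
          refine Finset.sum_le_sum_of_subset_of_nonneg (fun n hn => ?_) fun _ _ _ => norm_nonneg _
          exact mem_finsuppAntidiag_univ.2 (Finset.mem_filter.1 hn).2
      _ ≤ Real.exp (∑ x, ‖w x‖) := Real.sum_le_exp_of_nonneg hs K
  have hsum : Summable fun n => ‖termAt (partitionSeries W) w n‖ :=
    summable_of_sum_le (fun _ => norm_nonneg _) hle
  refine ⟨hsum, ?_, hsum.tsum_le_of_sum_le hle⟩
  have h := hsum.of_norm.hasSum.tsum_fiberwise Finsupp.degree
  refine h.tsum_eq.symm.trans (tsum_congr fun k => ?_)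
  have hset : Finsupp.degree ⁻¹' {k} = 
      ((Finset.univ.finsuppAntidiag k : Finset (X →₀ ℕ)) : Set (X →₀ ℕ)) := by
    ext n
    simp only [Set.mem_preimage, Set.mem_singleton_iff, Finset.mem_coe, mem_finsuppAntidiag_univ]
  rw [← sum_termAt_partitionSeries, ← Finset.tsum_subtype', hset]

/-- The Mayer series of a repulsive gas converges to `log Z_W` near `w = 0`. -/
theorem IsRepulsive.eventually_hasSum_mayerCoeff {W : Sym2 X → ℝ} (hW : IsRepulsive W) :
    ∀ᶠ w in 𝓝 (0 : X → ℂ),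
      HasSum (fun n : X →₀ ℕ => (mayerCoeff n W : ℂ) * ∏ x, w x ^ n x)
        (Complex.log (partitionFunction W w)) := by
  have hcont : ContinuousAt (fun w : X → ℂ => Real.exp (∑ x, ‖w x‖)) 0 :=
    Continuous.continuousAt (Real.continuous_exp.comp
      (continuous_finsetSum _ fun x _ => (continuous_apply x).norm))
  have hlt : ∀ᶠ w in 𝓝 (0 : X → ℂ), Real.exp (∑ x, ‖w x‖) < 2 :=
    hcont.eventually_lt_const (by simp)
  filter_upwards [hlt] with w hw
  have h := (hW.evaluatesTo_partitionFunction w).hasSum_log (constantCoeff_partitionSeries W) hw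
  exact h

end PartitionFunction

/-! ### Smoothness -/

section Smoothness

variable {X : Type*} [Fintype X] [DecidableEq X]

theorem contDiff_coeff_pow_partitionSeries_sub_one (m : ℕ) (n : X →₀ ℕ) :
    ContDiff ℝ ∞ fun W : Sym2 X → ℝ =>
      MvPowerSeries.coeff n ((partitionSeries W - 1) ^ m) := by
  induction m generalizing n with
  | zero => simpa using contDiff_const
  | succ m ih =>
    simp only [pow_succ, MvPowerSeries.coeff_mul, map_sub, coeff_partitionSeries,
      occupationWeight]
    refine ContDiff.sum fun p _ => (ih p.1).mul (ContDiff.sub (ContDiff.div_const ?_ _)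
      contDiff_const)
    exact contDiff_prod fun e _ => (contDiff_apply ℝ ℝ e).pow _

theorem contDiff_mayerCoeff (n : X →₀ ℕ) :
    ContDiff ℝ ∞ (mayerCoeff n : (Sym2 X → ℝ) → ℝ) := by
  have h : (mayerCoeff n : (Sym2 X → ℝ) → ℝ) = fun W => ∑ m ∈ Finset.range (n.degree + 1),
      PowerSeries.coeff m (PowerSeries.log ℝ) *
        MvPowerSeries.coeff n ((partitionSeries W - 1) ^ m) := by
    ext W
    exact coeff_log_subst (by simp [constantCoeff_partitionSeries]) n.degree.lt_succ_self
  rw [h]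
  exact ContDiff.sum fun m _ =>
    contDiff_const.mul (contDiff_coeff_pow_partitionSeries_sub_one m n)

end Smoothness

end LatticeGas

theorem proposition2p8 {X : Type*} [Fintype X] [DecidableEq X] :
    -- the numbers `c_n(W)` are the Taylor coefficients of `log Z_W` at `w = 0`
    (∀ W : Sym2 X → ℝ, LatticeGas.IsRepulsive W →
      ∀ᶠ w in 𝓝 (0 : X → ℂ),
        HasSum (fun n : X →₀ ℕ => (LatticeGas.mayerCoeff n W : ℂ) * ∏ x, w x ^ n x)
          (Complex.log (LatticeGas.partitionFunction W w))) ∧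
    -- the derivatives below exist
    (∀ n : X →₀ ℕ, ContDiff ℝ ∞ (LatticeGas.mayerCoeff n)) ∧
    -- the signs
    (∀ W : Sym2 X → ℝ, LatticeGas.IsRepulsive W → ∀ n : X →₀ ℕ,
      0 ≤ (-1 : ℝ) ^ ((n.degree : ℤ) - 1) * LatticeGas.mayerCoeff n W ∧
      (∀ x y : X, (-1 : ℝ) ^ ((n.degree : ℤ) - 1) *
        LatticeGas.partialDeriv s(x, y) (LatticeGas.mayerCoeff n) W ≤ 0) ∧
      (∀ x y x' y' : X, 0 ≤ (-1 : ℝ) ^ ((n.degree : ℤ) - 1) *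
        LatticeGas.partialDeriv s(x, y)
          (LatticeGas.partialDeriv s(x', y') (LatticeGas.mayerCoeff n)) W)) := by
  refine ⟨fun W hW => hW.eventually_hasSum_mayerCoeff, LatticeGas.contDiff_mayerCoeff,
    fun W hW n => ?_⟩
  have hsign : (-1 : ℝ) ^ ((n.degree : ℤ) - 1) = (-1) ^ (n.degree + 1) := by
    rw [zpow_sub₀ (by norm_num), zpow_natCast, pow_succ]
    simp [div_neg]
  rw [hsign]
  exact ⟨(LatticeGas.signedMayerCoeff_antitone hW hW le_rfl n).1,
    fun x y => LatticeGas.neg_one_pow_mul_partialDeriv_nonpos hW x y n,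
    fun x y x' y' => LatticeGas.neg_one_pow_mul_partialDeriv_partialDeriv_nonneg hW x y x' y' n⟩
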